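/- Let $H$ be a fixed finite digraph (loops allowed). The list $H$-coloring problem, restricted to input digraphs of small degree, asks: given a finite digraph $G$ with $\Delta^{+}(G)\le 2$ and $\Delta^{-}(G)\le 1$, or with $\Delta^{+}(G)\le 1$ and $\Delta^{-}(G)\le 2$, and a list $L(v)\subseteq V(H)$ for each $v\in V(G)$, is there a homomorphism $f:G\to H$ (that is, a map $f:V(G)\to V(H)$ such that $f(u)f(v)\in E(H)$ for every $uv\in E(G)$) with $f(v)\in L(v)$ for all $v\in V(G)$? Here $\Delta^{+}$ and $\Delta^{-}$ denote the maximum out-degree and the maximum in-degree. This problem is solvable in polynomial time: there is a (multi-stack, deterministic) Turing machine, depending only on $H$, that answers the question correctly on every such input $(G,L)$, given as the adjacency matrix of $G$ together with the lists, in a number of steps bounded by a polynomial in the length of the input. -/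

import Mathlib

/-- The out-degree of a vertex: the number of arcs `v → w` (a loop at `v` counts once). -/
noncomputable def Digraph.outDeg {V : Type*} (G : Digraph V) (v : V) : ℕ :=
  {w | G.Adj v w}.ncard

/-- The in-degree of a vertex: the number of arcs `u → v` (a loop at `v` counts once). -/
noncomputable def Digraph.inDeg {V : Type*} (G : Digraph V) (v : V) : ℕ :=
  {u | G.Adj u v}.ncard

/-- The maximum out-degree `Δ⁺` of a finite digraph (`0` if there are no vertices). -/
noncomputable def Digraph.maxOutDeg {V : Type*} [Fintype V] (G : Digraph V) : ℕ :=
  Finset.univ.sup G.outDeg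

/-- The maximum in-degree `Δ⁻` of a finite digraph (`0` if there are no vertices). -/
noncomputable def Digraph.maxInDeg {V : Type*} [Fintype V] (G : Digraph V) : ℕ :=
  Finset.univ.sup G.inDeg

/-- A homomorphism of digraphs: a map of the vertices that sends arcs to arcs and preserves their
direction. -/
def Digraph.IsHom {V W : Type*} (G : Digraph V) (H : Digraph W) (f : V → W) : Prop :=
  ∀ u v, G.Adj u v → H.Adj (f u) (f v)

/-- An input of the list colouring problem with colour set `W`: a finite digraph on the vertices
`0, …, n - 1`, and for each vertex a list of admissible colours. -/
structure ListColoringInput (W : Type) where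
  /-- the number of vertices -/
  n : ℕ
  /-- the input digraph -/
  graph : Digraph (Fin n)
  /-- the lists -/
  lists : Fin n → Finset W

namespace ListColoringInput

variable {W : Type}

/-- The question of the list `H`-colouring problem: is there a homomorphism to `H` that maps every
vertex into its list? -/
def HasListColoring (H : Digraph W) (I : ListColoringInput W) : Prop :=
  ∃ f : Fin I.n → W, I.graph.IsHom H f ∧ ∀ v, f v ∈ I.lists v

open Classical in
/-- One row of the encoding: the list of the vertex `i` (one symbol), followed by the row of `i`
in the adjacency matrix (`n` bits). -/
noncomputable def encodeRow (I : ListColoringInput W) (i : Fin I.n) : List (Finset W ⊕ Bool) :=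
  Sum.inl (I.lists i) :: List.ofFn fun j => Sum.inr (decide (I.graph.Adj i j))

/-- The input as a word: the adjacency matrix, row by row, where each row is headed by the list
of its vertex. The alphabet is finite and depends only on the colour set. -/
noncomputable def encode (I : ListColoringInput W) : List (Finset W ⊕ Bool) :=
  (List.ofFn I.encodeRow).flatten

theorem length_encodeRow (I : ListColoringInput W) (i : Fin I.n) :
    (I.encodeRow i).length = I.n + 1 := by
  simp [encodeRow]

theorem length_encode (I : ListColoringInput W) : I.encode.length = I.n * (I.n + 1) := by
  simp [encode, List.length_flatten, List.map_ofFn, Function.comp_def, length_encodeRow]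

/-- Different inputs have different encodings. -/
theorem encode_injective : Function.Injective (encode (W := W)) := by
  intro I J h
  have hn : I.n = J.n := by
    have := congrArg List.length h
    rw [length_encode, length_encode] at this
    nlinarith
  obtain ⟨n, G, L⟩ := I
  obtain ⟨m, G', L'⟩ := J
  obtain rfl : n = m := hn
  have hrows := List.eq_iff_flatten_eq.mpr ⟨h, by
    simp [List.map_ofFn, Function.comp_def, length_encodeRow]⟩
  have hrow := List.ofFn_injective hrows
  have key : ∀ i, L i = L' i ∧ ∀ j, G.Adj i j ↔ G'.Adj i j := by
    intro i
    have hi := congrFun hrow i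
    simp only [encodeRow, List.cons.injEq, Sum.inl.injEq] at hi
    refine ⟨hi.1, fun j => ?_⟩
    simpa using congrFun (List.ofFn_injective hi.2) j
  obtain rfl : L = L' := funext fun i => (key i).1
  obtain rfl : G = G' := by
    ext i j
    exact (key i).2 j
  rfl

end ListColoringInput

open Classical in
/-- A decision problem `P`, whose inputs are written as words by `enc`, is solvable in polynomial
time: some Turing machine answers `P` on every input, within a number of steps bounded by a
polynomial in the length of the encoded input. -/
def PolyTimeSolvable {α Γ : Type} (enc : α → List Γ) (P : α → Prop) : Prop :=
  Nonempty (Turing.TM2ComputableInPolyTime enc Computability.encodeBool fun a => decide (P a))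

/-! One of the maximum degrees is at most 1. If it is `Δ⁻`, every vertex has at most one
predecessor, so each weak component consists of out-trees hanging from a single root or a single
directed cycle. Fix the colour of one vertex `r`, the root or a vertex of the cycle, and let the
rest carry sets of colours that are consistent along every arc. Colours can then be chosen greedily
away from `r`. Only an arc back into `r` could cause trouble, and there the sole available colour is
the fixed one (`exists_hom_of_consistent`). The case of `Δ⁺` is the same with all arcs reversed.

Hence a list colouring exists if and only if every vertex `r` passes a singleton arc consistency
test, `ConsistentAt`. The test treats all colours of `r` at once: each vertex `i` stores pairs `(a,
x)`, meaning that `x` is still possible at `i` when `r` has colour `a`, and `r` starts with the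
diagonal. Pairs without support are deleted until nothing changes. A list colouring `f` keeps all
pairs `(f r, f i)` alive, so an empty set at `r` refutes colourability; a pair left at `r` gives a
consistent family by fixing its first coordinate.

A stack machine meets the matrix row by row, so each set is kept in two copies, one used as a row
and one as a column. A pass over the matrix revises both, and the next merge intersects them.
`Revises` records what a pass does, `RoundInvariant` gives correctness, and a potential that falls
in every round (`rounds_run`) bounds the time. -/

/-! ### From singleton arc consistency to a colouring. -/

/-- A family of colour sets that is contained in the lists, is consistent along every arc in both
directions, and is the singleton of one colour at the vertex `r`. -/
def ListColoringInput.ConsistentAt {W : Type} (H : Digraph W) (I : ListColoringInput W)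
    (r : Fin I.n) : Prop :=
  ∃ (a : W) (S : Fin I.n → Set W), S r = {a} ∧ (∀ v, ∀ x ∈ S v, x ∈ I.lists v) ∧
    (∀ u v, I.graph.Adj u v → ∀ x ∈ S u, ∃ y ∈ S v, H.Adj x y) ∧
    ∀ u v, I.graph.Adj u v → ∀ y ∈ S v, ∃ x ∈ S u, H.Adj x y

/-- Every self-map of a finite type has a choice of a recurrent point in each forward orbit that is
constant along orbits. -/
theorem exists_recurrent_representative {V : Type*} [Finite V] (p : V → V) :
    ∃ r : V → V, (∀ v, r (p v) = r v) ∧ ∀ v, ∃ k, p^[k] v = r v := by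
  -- The points that the orbit of `v` visits infinitely often: some exist by pigeonhole, and
  -- deleting the first point of the orbit does not change them. A point chosen from the set `C v`
  -- is therefore constant along orbits.
  let C : V → Set V := fun v => {w | {k | p^[k] v = w}.Infinite}
  have hC : ∀ v, (C v).Nonempty := by
    intro v
    obtain ⟨w, hw⟩ := Finite.exists_infinite_fiber (fun k : ℕ => p^[k] v)
    exact ⟨w, Set.infinite_coe_iff.mp hw⟩
  have hp : ∀ v, C (p v) = C v := by
    intro v
    ext w
    have hshift : Nat.succ '' {k | p^[k] (p v) = w} = {k | p^[k] v = w} \ {0} := by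
      ext k
      cases k <;> simp
    have : {k | p^[k] (p v) = w}.Infinite ↔ {k | p^[k] v = w}.Infinite := by
      rw [← Set.infinite_image_iff Nat.succ_injective.injOn, hshift]
      refine ⟨fun h => h.mono Set.sdiff_subset, fun h => h.sdiff (Set.finite_singleton 0)⟩
    exact this
  have hsome : ∀ (s t : Set V) (hs : s.Nonempty) (ht : t.Nonempty), s = t → hs.some = ht.some := by
    rintro s _ hs ht rfl
    rfl
  refine ⟨fun v => (hC v).some, fun v => hsome _ _ _ _ (hp v), fun v => ?_⟩
  exact (hC v).some_mem.nonempty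

/-- Following unique predecessors leads from each vertex `v` back to a representative `r v`. Colour
`r v` by `a (r v)`, and colour the other vertices by recursion on the distance `d` to the
representative, taking a support of the predecessor's colour in the family `S (r v)`. -/
theorem exists_hom_of_consistent {V W : Type*} [Finite V] {E : V → V → Prop} {F : W → W → Prop}
    (hE : ∀ u u' v, E u v → E u' v → u = u') (a : V → W) (S : V → V → Set W)
    (ha : ∀ r, S r r = {a r})
    (hS : ∀ r u v, E u v → ∀ x ∈ S r u, ∃ y ∈ S r v, F x y) :
    ∃ f : V → W, (∀ u v, E u v → F (f u) (f v)) ∧ ∀ v, ∃ r, f v ∈ S r v := by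
  classical
  let p : V → V := fun v => if h : ∃ u, E u v then h.choose else v
  have hp : ∀ u v, E u v → p v = u := by
    intro u v h
    have h' : ∃ u, E u v := ⟨u, h⟩
    simp only [p, dif_pos h']
    exact hE _ _ _ h'.choose_spec h
  have hroot : ∀ v, p v ≠ v → E (p v) v := by
    intro v hv
    by_cases h' : ∃ u, E u v
    · simp only [p, dif_pos h']
      exact h'.choose_spec
    · exact absurd (by simp [p, h']) hv
  obtain ⟨r, hr, hrk⟩ := exists_recurrent_representative p
  let d : V → ℕ := fun v => Nat.find (hrk v)
  have hd0 : ∀ v, d v = 0 ↔ v = r v := fun v => by simp [d, Nat.find_eq_zero]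
  have hd : ∀ v, v ≠ r v → d v = d (p v) + 1 := by
    intro v hv
    apply le_antisymm
    · refine Nat.find_min' _ ?_
      rw [Function.iterate_succ_apply, ← hr v]
      exact Nat.find_spec (hrk (p v))
    · have h1 : d v ≠ 0 := fun h => hv ((hd0 v).1 h)
      obtain ⟨k, hk⟩ := Nat.exists_eq_succ_of_ne_zero h1
      rw [hk]
      refine Nat.succ_le_succ (Nat.find_min' _ ?_)
      rw [hr v, ← Function.iterate_succ_apply, ← hk]
      exact Nat.find_spec (hrk v)
  let c : V → W → W := fun v x => if h : ∃ y ∈ S (r v) v, F x y then h.choose else x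
  have hc : ∀ v, E (p v) v → ∀ x ∈ S (r v) (p v), c v x ∈ S (r v) v ∧ F x (c v x) := by
    intro v hv x hx
    have h := hS _ _ _ hv x hx
    simp only [c, dif_pos h]
    exact h.choose_spec
  -- The fuel `k` replaces a recursion along `p`; the value is meaningful only at `k = d v`.
  let g : ℕ → V → W := fun k => Nat.rec (fun v => a (r v)) (fun _ G v => c v (G (p v))) k
  have hE' : ∀ v, v ≠ r v → E (p v) v := by
    refine fun v hv => hroot v fun h => hv ?_
    have := hd v hv
    rw [h] at this
    omega
  have hmem : ∀ k v, d v = k → g k v ∈ S (r v) v := by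
    intro k
    induction k with
    | zero =>
      intro v hv
      rw [hd0] at hv
      have : g 0 v = a (r v) := rfl
      rw [this, ← hv, ha]
      rfl
    | succ k ih =>
      intro v hv
      have hv' : v ≠ r v := fun h => by rw [(hd0 v).2 h] at hv; omega
      have := hd v hv'
      refine (hc v (hE' v hv') _ ?_).1
      rw [← hr v]
      exact ih (p v) (by omega)
  refine ⟨fun v => g (d v) v, fun u v huv => ?_, fun v => ⟨r v, hmem _ v rfl⟩⟩
  have hpv := hp u v huv
  have hru : r u = r v := by rw [← hpv, hr]
  have hu := hmem _ u rfl
  by_cases hv : v = r v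
  -- An arc into the representative closes the cycle: the support of the colour of `u` lies in `S (r
  -- v) (r v)`, whose only element is the colour already given.
  · obtain ⟨y, hy, hxy⟩ := hS _ _ _ huv _ hu
    have hv' := hmem _ v rfl
    rw [hru, ← hv, ha] at hy
    rw [← hv, ha] at hv'
    rw [Set.mem_singleton_iff] at hy hv'
    simp only [hv', ← hy]
    exact hxy
  · have h := hd v hv
    have : g (d v) v = c v (g (d u) u) := by
      rw [h, ← hpv]
    simp only [this]
    subst hpv
    exact (hc v huv _ (hru ▸ hu)).2

theorem Digraph.eq_of_adj_of_maxInDeg_le_one {V : Type*} [Fintype V] {G : Digraph V}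
    (h : G.maxInDeg ≤ 1) {u u' v : V} (hu : G.Adj u v) (hu' : G.Adj u' v) : u = u' :=
  (Set.ncard_le_one (Set.toFinite _)).1
    ((Finset.le_sup (f := G.inDeg) (Finset.mem_univ v)).trans h) u hu u' hu'

theorem Digraph.eq_of_adj_of_maxOutDeg_le_one {V : Type*} [Fintype V] {G : Digraph V}
    (h : G.maxOutDeg ≤ 1) {u v v' : V} (hv : G.Adj u v) (hv' : G.Adj u v') : v = v' :=
  (Set.ncard_le_one (Set.toFinite _)).1
    ((Finset.le_sup (f := G.outDeg) (Finset.mem_univ u)).trans h) v hv v' hv'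

/-- Consistency against the direction of the arcs serves the case of out-degree at most 1, where the
arcs of both digraphs are reversed. -/
theorem ListColoringInput.hasListColoring_of_consistentAt {W : Type} {H : Digraph W}
    {I : ListColoringInput W} (hI : I.graph.maxInDeg ≤ 1 ∨ I.graph.maxOutDeg ≤ 1)
    (h : ∀ r, I.ConsistentAt H r) : I.HasListColoring H := by
  choose a S ha hL hout hin using h
  rcases hI with hI | hI
  · obtain ⟨f, hf, hmem⟩ := exists_hom_of_consistent (E := I.graph.Adj) (F := H.Adj)
      (fun _ _ _ => Digraph.eq_of_adj_of_maxInDeg_le_one hI) a S ha hout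
    exact ⟨f, hf, fun v => (hmem v).elim fun r hr => hL r v _ hr⟩
  · obtain ⟨f, hf, hmem⟩ := exists_hom_of_consistent (E := fun u v => I.graph.Adj v u)
      (F := fun x y => H.Adj y x)
      (fun _ _ _ => Digraph.eq_of_adj_of_maxOutDeg_le_one hI) a S ha
      (fun r u v => hin r v u)
    exact ⟨f, fun u v huv => hf v u huv, fun v => (hmem v).elim fun r hr => hL r v _ hr⟩

/-! ### Runs with a bounded number of steps. -/

open Turing StateTransition

/-- `f` leads from `a` to `b` in at most `t` steps. -/
def ReachesIn {σ : Type*} (f : σ → Option σ) (t : ℕ) (a b : σ) : Prop :=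
  ∃ s ≤ t, (flip bind f)^[s] (some a) = some b

namespace ReachesIn

variable {σ : Type*} {f : σ → Option σ} {a b c : σ} {s t : ℕ}

theorem refl (a : σ) : ReachesIn f 0 a a := ⟨0, le_rfl, rfl⟩

theorem single (h : f a = some b) : ReachesIn f 1 a b := ⟨1, le_rfl, h⟩

theorem mono (h : ReachesIn f s a b) (hst : s ≤ t) : ReachesIn f t a b :=
  h.imp fun _ h => ⟨h.1.trans hst, h.2⟩

theorem trans (h₁ : ReachesIn f s a b) (h₂ : ReachesIn f t b c) : ReachesIn f (s + t) a c := by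
  obtain ⟨s', hs, h₁⟩ := h₁
  obtain ⟨t', ht, h₂⟩ := h₂
  exact ⟨t' + s', by omega, by rw [Function.iterate_add_apply, h₁, h₂]⟩

theorem head (h : f a = some b) (h₂ : ReachesIn f t b c) : ReachesIn f (t + 1) a c :=
  ((single h).trans h₂).mono (by omega)

end ReachesIn

/-! ### The machine. -/

namespace ListColoringMachine

variable {W : Type}

/-- The store of the machine; each of the three work store has a companion to which it is moved
while it is read. -/
inductive Stack
  | input | output | rows | rows' | cols | cols' | cells | cells'
  deriving DecidableEq

instance : Fintype Stack :=
  ⟨{.input, .output, .rows, .rows', .cols, .cols', .cells, .cells'}, fun k => by cases k <;> decide⟩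

/-- What is stored for a row: the list of the vertex, a mark, and a set of pairs `(a, x)`, meaning
that the vertex may get the colour `x` if the marked vertex gets the colour `a`. -/
abbrev RowSymbol (W : Type) := Finset W × Bool × Finset (W × W)

/-- The alphabets of the store. -/
abbrev Alphabet (W : Type) : Stack → Type
  | .input => Finset W ⊕ Bool
  | .output => Bool
  | .rows | .rows' => RowSymbol W
  | .cols | .cols' => Finset (W × W)
  | .cells | .cells' => Bool

/-- The labels of the machine. -/
inductive Label
  | parse | unreadCells | merge | nextRow | scanRow | rewindCols | flipCols | clear
  deriving DecidableEq

instance : Fintype Label :=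
  ⟨{.parse, .unreadCells, .merge, .nextRow, .scanRow, .rewindCols, .flipCols, .clear},
    fun l => by cases l <;> decide⟩

/-- The internal states of the machine: five flags and a register for each alphabet. -/
structure State (W : Type) where
  /-- the next merge moves the mark and starts anew -/
  restart : Bool
  /-- some set has become smaller since the last merge -/
  changed : Bool
  /-- the mark that is carried to the next row -/
  carry : Bool
  /-- the marked vertex has run out of colours -/
  failed : Bool
  /-- the answer is known -/
  finished : Bool
  /-- the register of the input alphabet -/
  sym : Option (Finset W ⊕ Bool)
  /-- the register for a row -/
  row : Option (RowSymbol W)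
  /-- the register for a column -/
  col : Option (Finset (W × W))
  /-- the register for an entry of the matrix -/
  cell : Option Bool

noncomputable instance [Fintype W] : Fintype (State W) := by
  classical
  exact Fintype.ofInjective
    (fun s : State W => (s.restart, s.changed, s.carry, s.failed, s.finished, s.sym, s.row, s.col,
      s.cell)) (by rintro ⟨⟩ ⟨⟩ h; simpa using h)

/-- The initial state. -/
def State.start : State W := ⟨false, false, true, false, false, none, none, none, none⟩

open Classical in
/-- Revise the set of a row by the set of a column. -/
noncomputable def reviseRow (H : Digraph W) (A B : Finset (W × W)) : Finset (W × W) :=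
  A.filter fun p => ∃ y, (p.1, y) ∈ B ∧ H.Adj p.2 y

open Classical in
/-- Revise the set of a column by the set of a row. -/
noncomputable def reviseCol (H : Digraph W) (A B : Finset (W × W)) : Finset (W × W) :=
  B.filter fun p => ∃ x, (p.1, x) ∈ A ∧ H.Adj x p.2

open Classical in
/-- The set of pairs with which a vertex starts: every colour of its list, or, if it is the marked
vertex, the diagonal of its list. -/
noncomputable def initialPairs [Fintype W] (mark : Bool) (L : Finset W) : Finset (W × W) :=
  Finset.univ.filter fun p => p.2 ∈ L ∧ (mark → p.1 = p.2)

open Classical in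
/-- The effect of `Label.scanRow` on the registers, at an entry of the matrix. -/
noncomputable def scanStep (H : Digraph W) : State W → State W
  | ⟨r, ch, ca, fa, fi, sy, some (L, m, A), some B, some true⟩ =>
    ⟨r, ch || !decide (reviseRow H A B = A ∧ reviseCol H A B = B), ca, fa, fi, sy,
      some (L, m, reviseRow H A B), some (reviseCol H A B), some true⟩
  | s => s

open Classical in
/-- The effect of `Label.merge` on the registers, at a vertex. -/
noncomputable def mergeStep [Fintype W] : State W → State W
  | ⟨true, ch, ca, fa, fi, sy, some (L, m, A), _, ce⟩ =>
    ⟨true, ch, m, fa || (m && decide (A = ∅)), fi, sy, some (L, ca, initialPairs ca L),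
      some (initialPairs ca L), ce⟩
  | ⟨false, ch, ca, fa, fi, sy, some (L, m, A), some B, ce⟩ =>
    ⟨false, ch || !decide (A = B), ca, fa, fi, sy, some (L, m, A ∩ B), some (A ∩ B), ce⟩
  | s => s

open TM2.Stmt in
/-- The program of the machine. -/
noncomputable def program [Fintype W] (H : Digraph W) :
    Label → TM2.Stmt (Alphabet W) Label (State W)
  | .parse =>
    pop .input (fun s x => { s with sym := x }) <|
    branch (fun s => s.sym.isSome)
      (branch (fun s => s.sym.any Sum.isLeft)
        (push .rows' (fun s => ((s.sym.bind Sum.getLeft?).getD ∅, false, ∅)) <|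
          push .cols' (fun _ => (∅ : Finset (W × W))) <| goto fun _ => .parse)
        (push .cells' (fun s => (s.sym.bind Sum.getRight?).getD false) <| goto fun _ => .parse))
      (goto fun _ => .unreadCells)
  | .unreadCells =>
    pop .cells' (fun s x => { s with cell := x }) <|
    branch (fun s => s.cell.isSome)
      (push .cells (fun s => s.cell.getD false) <| goto fun _ => .unreadCells)
      (load (fun s => { s with restart := !s.changed, changed := !s.changed }) <|
        goto fun _ => .merge)
  | .merge =>
    pop .rows' (fun s x => { s with row := x }) <|
    pop .cols' (fun s x => { s with col := x }) <|
    branch (fun s => s.row.isSome)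
      (load mergeStep <|
        push .rows (fun s => s.row.getD (∅, false, ∅)) <|
        push .cols (fun s => s.col.getD ∅) <| goto fun _ => .merge)
      (load (fun s => { s with
          finished := s.restart && (s.carry || s.failed), restart := false }) <|
        goto fun _ => .nextRow)
  | .nextRow =>
    pop .rows (fun s x => { s with row := x }) <|
    branch (fun s => s.row.isSome) (goto fun _ => .scanRow) (goto fun _ => .flipCols)
  | .scanRow =>
    pop .cols (fun s x => { s with col := x }) <|
    branch (fun s => s.col.isSome)
      (pop .cells (fun s x => { s with cell := x }) <|
        load (scanStep H) <|
        push .cols' (fun s => s.col.getD ∅) <|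
        push .cells' (fun s => s.cell.getD false) <|
        load (fun s => { s with cell := none }) <| goto fun _ => .scanRow)
      (push .rows' (fun s => s.row.getD (∅, false, ∅)) <|
        load (fun s => { s with row := none }) <| goto fun _ => .rewindCols)
  | .rewindCols =>
    pop .cols' (fun s x => { s with col := x }) <|
    branch (fun s => s.col.isSome)
      (push .cols (fun s => s.col.getD ∅) <| goto fun _ => .rewindCols)
      (goto fun _ => .nextRow)
  | .flipCols =>
    pop .cols (fun s x => { s with col := x }) <|
    branch (fun s => s.col.isSome)
      (push .cols' (fun s => s.col.getD ∅) <| goto fun _ => .flipCols)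
      (branch (fun s => s.finished) (goto fun _ => .clear) (goto fun _ => .unreadCells))
  | .clear =>
    pop .rows' (fun s x => { s with row := x }) <|
    pop .cols' (fun s x => { s with col := x }) <|
    pop .cells' (fun s x => { s with cell := x }) <|
    branch (fun s => s.row.isSome || s.cell.isSome) (goto fun _ => .clear)
      (push .output (fun s => !s.failed) <| load (fun _ => .start) halt)

/-- The contents of all store. -/
def store (i : List (Finset W ⊕ Bool)) (o : List Bool) (r r' : List (RowSymbol W))
    (c c' : List (Finset (W × W))) (e e' : List Bool) : ∀ k, List (Alphabet W k)
  | .input => i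
  | .output => o
  | .rows => r
  | .rows' => r'
  | .cols => c
  | .cols' => c'
  | .cells => e
  | .cells' => e'

/-! ### Stack operations on explicit stores. -/

section stepAux

variable (i : List (Finset W ⊕ Bool)) (o : List Bool) (r r' : List (RowSymbol W))
  (c c' : List (Finset (W × W))) (e e' : List Bool) (s : State W)
  (q : TM2.Stmt (Alphabet W) Label (State W))

-- This and its companions keep every configuration in the form `store ..`. In the runs below they
-- replace the defining equations of push and pop, `TM2.stepAux.eq_1` and `TM2.stepAux.eq_3`, which
-- would produce `Function.update`.
@[simp] theorem stepAux_pop_input (f : State W → Option (Finset W ⊕ Bool) → State W) :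
    TM2.stepAux (.pop .input f q) s (store i o r r' c c' e e') =
      TM2.stepAux q (f s i.head?) (store i.tail o r r' c c' e e') := by
  refine congrArg (TM2.stepAux q _) ?_
  funext k
  cases k <;> rfl

@[simp] theorem stepAux_push_output (f : State W → Bool) :
    TM2.stepAux (.push .output f q) s (store i o r r' c c' e e') =
      TM2.stepAux q s (store i (f s :: o) r r' c c' e e') := by
  refine congrArg (TM2.stepAux q _) ?_
  funext k
  cases k <;> rfl

@[simp] theorem stepAux_pop_rows (f : State W → Option (RowSymbol W) → State W) :
    TM2.stepAux (.pop .rows f q) s (store i o r r' c c' e e') =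
      TM2.stepAux q (f s r.head?) (store i o r.tail r' c c' e e') := by
  refine congrArg (TM2.stepAux q _) ?_
  funext k
  cases k <;> rfl

@[simp] theorem stepAux_push_rows (f : State W → RowSymbol W) :
    TM2.stepAux (.push .rows f q) s (store i o r r' c c' e e') =
      TM2.stepAux q s (store i o (f s :: r) r' c c' e e') := by
  refine congrArg (TM2.stepAux q _) ?_
  funext k
  cases k <;> rfl

@[simp] theorem stepAux_pop_rows' (f : State W → Option (RowSymbol W) → State W) :
    TM2.stepAux (.pop .rows' f q) s (store i o r r' c c' e e') =
      TM2.stepAux q (f s r'.head?) (store i o r r'.tail c c' e e') := by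
  refine congrArg (TM2.stepAux q _) ?_
  funext k
  cases k <;> rfl

@[simp] theorem stepAux_push_rows' (f : State W → RowSymbol W) :
    TM2.stepAux (.push .rows' f q) s (store i o r r' c c' e e') =
      TM2.stepAux q s (store i o r (f s :: r') c c' e e') := by
  refine congrArg (TM2.stepAux q _) ?_
  funext k
  cases k <;> rfl

@[simp] theorem stepAux_pop_cols (f : State W → Option (Finset (W × W)) → State W) :
    TM2.stepAux (.pop .cols f q) s (store i o r r' c c' e e') =
      TM2.stepAux q (f s c.head?) (store i o r r' c.tail c' e e') := by
  refine congrArg (TM2.stepAux q _) ?_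
  funext k
  cases k <;> rfl

@[simp] theorem stepAux_push_cols (f : State W → Finset (W × W)) :
    TM2.stepAux (.push .cols f q) s (store i o r r' c c' e e') =
      TM2.stepAux q s (store i o r r' (f s :: c) c' e e') := by
  refine congrArg (TM2.stepAux q _) ?_
  funext k
  cases k <;> rfl

@[simp] theorem stepAux_pop_cols' (f : State W → Option (Finset (W × W)) → State W) :
    TM2.stepAux (.pop .cols' f q) s (store i o r r' c c' e e') =
      TM2.stepAux q (f s c'.head?) (store i o r r' c c'.tail e e') := by
  refine congrArg (TM2.stepAux q _) ?_
  funext k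
  cases k <;> rfl

@[simp] theorem stepAux_push_cols' (f : State W → Finset (W × W)) :
    TM2.stepAux (.push .cols' f q) s (store i o r r' c c' e e') =
      TM2.stepAux q s (store i o r r' c (f s :: c') e e') := by
  refine congrArg (TM2.stepAux q _) ?_
  funext k
  cases k <;> rfl

@[simp] theorem stepAux_pop_cells (f : State W → Option (Bool) → State W) :
    TM2.stepAux (.pop .cells f q) s (store i o r r' c c' e e') =
      TM2.stepAux q (f s e.head?) (store i o r r' c c' e.tail e') := by
  refine congrArg (TM2.stepAux q _) ?_
  funext k
  cases k <;> rfl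

@[simp] theorem stepAux_push_cells (f : State W → Bool) :
    TM2.stepAux (.push .cells f q) s (store i o r r' c c' e e') =
      TM2.stepAux q s (store i o r r' c c' (f s :: e) e') := by
  refine congrArg (TM2.stepAux q _) ?_
  funext k
  cases k <;> rfl

@[simp] theorem stepAux_pop_cells' (f : State W → Option (Bool) → State W) :
    TM2.stepAux (.pop .cells' f q) s (store i o r r' c c' e e') =
      TM2.stepAux q (f s e'.head?) (store i o r r' c c' e e'.tail) := by
  refine congrArg (TM2.stepAux q _) ?_
  funext k
  cases k <;> rfl

@[simp] theorem stepAux_push_cells' (f : State W → Bool) :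
    TM2.stepAux (.push .cells' f q) s (store i o r r' c c' e e') =
      TM2.stepAux q s (store i o r r' c c' e (f s :: e')) := by
  refine congrArg (TM2.stepAux q _) ?_
  funext k
  cases k <;> rfl

end stepAux

/-! ### What a pass over the matrix does to the sets of pairs. -/

/-- The two sets of pairs support each other along an arc of `H`. -/
def Supports (H : Digraph W) (A B : Finset (W × W)) : Prop :=
  (∀ a x, (a, x) ∈ A → ∃ y, (a, y) ∈ B ∧ H.Adj x y) ∧
    ∀ a y, (a, y) ∈ B → ∃ x, (a, x) ∈ A ∧ H.Adj x y

/-- What reading the rows `adj` of the matrix does to the sets `A` of the rows, the sets `B` of the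
columns and the flag `ch`. -/
structure Revises (H : Digraph W) {m n : ℕ} (adj : Fin m → Fin n → Bool)
    (A : Fin m → Finset (W × W)) (B : Fin n → Finset (W × W)) (ch : Bool)
    (A' : Fin m → Finset (W × W)) (B' : Fin n → Finset (W × W)) (ch' : Bool) : Prop where
  subset_row : ∀ i, A' i ⊆ A i
  subset_col : ∀ j, B' j ⊆ B j
  card_le : ∑ i, (A' i).card + ∑ j, (B' j).card + ch'.toNat ≤
    ∑ i, (A i).card + ∑ j, (B j).card + ch.toNat
  stable : ch' = false → ch = false ∧ A' = A ∧ B' = B ∧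
    ∀ i j, adj i j = true → Supports H (A i) (B j)
  sound : ∀ (a : W) (x : Fin m → W) (y : Fin n → W), (∀ i, (a, x i) ∈ A i) → (∀ j, (a, y j) ∈ B j) →
    (∀ i j, adj i j = true → H.Adj (x i) (y j)) →
    (∀ i, (a, x i) ∈ A' i) ∧ ∀ j, (a, y j) ∈ B' j

theorem Revises.refl (H : Digraph W) {m n : ℕ} (adj : Fin m → Fin n → Bool) (A B ch)
    (h : ∀ i j, adj i j = false) : Revises H adj A B ch A B ch where
  subset_row _ := subset_rfl
  subset_col _ := subset_rfl
  card_le := le_rfl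
  stable hc := ⟨hc, rfl, rfl, fun i j hij => by simp [h] at hij⟩
  sound _ _ _ hA hB _ := ⟨hA, hB⟩

open Classical in
theorem reviseRow_subset (H : Digraph W) (A B) : reviseRow H A B ⊆ A :=
  Finset.filter_subset _ _

open Classical in
theorem reviseCol_subset (H : Digraph W) (A B) : reviseCol H A B ⊆ B :=
  Finset.filter_subset _ _

open Classical in
theorem revises_cell (H : Digraph W) (A B : Finset (W × W)) (ch : Bool) :
    Revises H (fun _ _ : Fin 1 => true) (fun _ => A) (fun _ => B) ch (fun _ => reviseRow H A B)
      (fun _ => reviseCol H A B)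
      (ch || !decide (reviseRow H A B = A ∧ reviseCol H A B = B)) where
  subset_row _ := reviseRow_subset H A B
  subset_col _ := reviseCol_subset H A B
  card_le := by
    have h₁ := Finset.card_le_card (reviseRow_subset H A B)
    have h₂ := Finset.card_le_card (reviseCol_subset H A B)
    -- Raising the flag adds at most 1 to the potential, which is paid for by a deleted pair.
    have h₃ : ¬(reviseRow H A B = A ∧ reviseCol H A B = B) →
        (reviseRow H A B).card + (reviseCol H A B).card + 1 ≤ A.card + B.card := by
      intro h
      by_contra hlt
      exact h ⟨Finset.eq_of_subset_of_card_le (reviseRow_subset H A B) (by omega),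
        Finset.eq_of_subset_of_card_le (reviseCol_subset H A B) (by omega)⟩
    simp only [Finset.univ_unique, Finset.sum_singleton]
    by_cases h : reviseRow H A B = A ∧ reviseCol H A B = B
    · simp [h]
    · have := h₃ h
      cases ch <;> simp [h] <;> omega
  stable hc := by
    simp only [Bool.or_eq_false_iff, Bool.not_eq_false', decide_eq_true_eq] at hc
    obtain ⟨hc, hA, hB⟩ := hc
    refine ⟨hc, by simp [hA], by simp [hB], fun _ _ _ => ⟨fun a x h => ?_, fun a y h => ?_⟩⟩
    · rw [← hA] at h
      exact (Finset.mem_filter.1 h).2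
    · rw [← hB] at h
      exact (Finset.mem_filter.1 h).2
  sound a x y hA hB h :=
    ⟨fun i => Finset.mem_filter.2 ⟨hA i, y 0, hB 0, h i 0 rfl⟩,
      fun j => Finset.mem_filter.2 ⟨hB j, x 0, hA 0, h 0 j rfl⟩⟩

/-- Passes compose. For `stable`, a flag that is down at the end was down in between, so the second
pass left everything unchanged and so did the first; the supports found at different moments thus
concern the same sets. -/
theorem Revises.cons_col {H : Digraph W} {n : ℕ} {bit : Bool} {bits : Fin n → Bool}
    {A A₁ A₂ : Finset (W × W)} {B₀ B₀' : Finset (W × W)} {B B' : Fin n → Finset (W × W)}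
    {ch ch₁ ch₂ : Bool}
    (h₁ : Revises H (fun _ _ : Fin 1 => bit) (fun _ => A) (fun _ => B₀) ch (fun _ => A₁)
      (fun _ => B₀') ch₁)
    (h₂ : Revises H (fun _ : Fin 1 => bits) (fun _ => A₁) B ch₁ (fun _ => A₂) B' ch₂) :
    Revises H (fun _ : Fin 1 => (Fin.cons bit bits : Fin (n + 1) → Bool)) (fun _ => A)
      (Fin.cons B₀ B) ch (fun _ => A₂) (Fin.cons B₀' B') ch₂ where
  subset_row i := (h₂.subset_row i).trans (h₁.subset_row i)
  subset_col := Fin.forall_fin_succ.2 ⟨h₁.subset_col 0, h₂.subset_col⟩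
  card_le := by
    have h₁ := h₁.card_le
    have h₂ := h₂.card_le
    simp only [Finset.univ_unique, Finset.sum_singleton, Fin.sum_univ_succ, Fin.cons_zero,
      Fin.cons_succ] at h₁ h₂ ⊢
    omega
  stable hc := by
    obtain ⟨hc, hA, hB, hs⟩ := h₂.stable hc
    obtain ⟨hc, hA₁, hB₁, hs₁⟩ := h₁.stable hc
    have hA₁ : A₁ = A := congrFun hA₁ 0
    have hB₁ : B₀' = B₀ := congrFun hB₁ 0
    subst hA₁ hB₁
    exact ⟨hc, hA, by rw [hB], fun i => Fin.forall_fin_succ.2 ⟨hs₁ i 0, hs i⟩⟩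
  sound a x y hA hB h := by
    have h₁ := h₁.sound a x (fun _ => y 0) hA (fun _ => hB 0) (fun i _ => h i 0)
    have h₂ := h₂.sound a x (fun j => y j.succ) h₁.1 (fun j => hB j.succ) (fun i j => h i j.succ)
    exact ⟨h₂.1, Fin.forall_fin_succ.2 ⟨h₁.2 0, h₂.2⟩⟩

theorem Revises.cons_row {H : Digraph W} {m n : ℕ} {bits : Fin n → Bool}
    {adj : Fin m → Fin n → Bool} {A₀ A₀' : Finset (W × W)} {A A' : Fin m → Finset (W × W)}
    {B B₁ B₂ : Fin n → Finset (W × W)} {ch ch₁ ch₂ : Bool}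
    (h₁ : Revises H (fun _ : Fin 1 => bits) (fun _ => A₀) B ch (fun _ => A₀') B₁ ch₁)
    (h₂ : Revises H adj A B₁ ch₁ A' B₂ ch₂) :
    Revises H (Fin.cons bits adj : Fin (m + 1) → Fin n → Bool) (Fin.cons A₀ A) B ch
      (Fin.cons A₀' A') B₂ ch₂ where
  subset_row := Fin.forall_fin_succ.2 ⟨h₁.subset_row 0, h₂.subset_row⟩
  subset_col j := (h₂.subset_col j).trans (h₁.subset_col j)
  card_le := by
    have h₁ := h₁.card_le
    have h₂ := h₂.card_le
    simp only [Finset.univ_unique, Finset.sum_singleton, Fin.sum_univ_succ (n := m),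
      Fin.cons_zero, Fin.cons_succ] at h₁ h₂ ⊢
    omega
  stable hc := by
    obtain ⟨hc, hA, hB, hs⟩ := h₂.stable hc
    obtain ⟨hc, hA₁, hB₁, hs₁⟩ := h₁.stable hc
    have hA₁ : A₀' = A₀ := congrFun hA₁ 0
    subst hA₁ hB₁
    exact ⟨hc, by rw [hA], hB, Fin.forall_fin_succ.2 ⟨hs₁ 0, hs⟩⟩
  sound a x y hA hB h := by
    have h₁ := h₁.sound a (fun _ => x 0) y (fun _ => hA 0) hB (fun _ => h 0)
    have h₂ := h₂.sound a (fun i => x i.succ) y (fun i => hA i.succ) h₁.2 (fun i => h i.succ)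
    exact ⟨Fin.forall_fin_succ.2 ⟨h₁.1 0, h₂.1⟩, h₂.2⟩

/-! ### Runs of the individual loops. -/

section loops

variable [Fintype W] {H : Digraph W}
  (i : List (Finset W ⊕ Bool)) (o : List Bool) (r r' : List (RowSymbol W))
  (c c' : List (Finset (W × W))) (e e' : List Bool) (re ch ca fa fi : Bool)
  (ρ : Option (RowSymbol W)) (β : Option (Finset (W × W))) (γ : Option Bool)

/-- Both flags become `!ch`. After a change the next merge intersects, with the change flag reset;
after a quiet pass it restarts, with the flag up so that the fresh sets get at least one
intersecting round. -/
theorem unreadCells_run :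
    ReachesIn (TM2.step (program H)) (e'.length + 1)
      ⟨some .unreadCells, ⟨re, ch, ca, fa, fi, none, ρ, β, γ⟩, store i o r r' c c' e e'⟩
      ⟨some .merge, ⟨!ch, !ch, ca, fa, fi, none, ρ, β, none⟩,
        store i o r r' c c' (e'.reverse ++ e) []⟩ := by
  induction e' generalizing e γ with
  | nil => exact .single (by simp [program, -TM2.stepAux.eq_1, -TM2.stepAux.eq_3])
  | cons b e' ih =>
    rw [List.reverse_cons, List.append_assoc]
    refine .head ?_ (ih (b :: e) (some b))
    simp [program, -TM2.stepAux.eq_1, -TM2.stepAux.eq_3]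

theorem flipCols_run :
    ReachesIn (TM2.step (program H)) (c.length + 1)
      ⟨some .flipCols, ⟨re, ch, ca, fa, fi, none, ρ, β, γ⟩, store i o r r' c c' e e'⟩
      ⟨some (if fi then .clear else .unreadCells), ⟨re, ch, ca, fa, fi, none, ρ, none, γ⟩,
        store i o r r' [] (c.reverse ++ c') e e'⟩ := by
  induction c generalizing c' β with
  | nil =>
    exact .single (by cases fi <;> simp [program, -TM2.stepAux.eq_1, -TM2.stepAux.eq_3])
  | cons b c ih =>
    rw [List.reverse_cons, List.append_assoc]
    refine .head ?_ (ih (b :: c') (some b))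
    simp [program, -TM2.stepAux.eq_1, -TM2.stepAux.eq_3]

theorem rewindCols_run :
    ReachesIn (TM2.step (program H)) (c'.length + 1)
      ⟨some .rewindCols, ⟨re, ch, ca, fa, fi, none, ρ, β, γ⟩, store i o r r' c c' e e'⟩
      ⟨some .nextRow, ⟨re, ch, ca, fa, fi, none, ρ, none, γ⟩,
        store i o r r' (c'.reverse ++ c) [] e e'⟩ := by
  induction c' generalizing c β with
  | nil => exact .single (by simp [program, -TM2.stepAux.eq_1, -TM2.stepAux.eq_3])
  | cons b c' ih =>
    rw [List.reverse_cons, List.append_assoc]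
    refine .head ?_ (ih (b :: c) (some b))
    simp [program, -TM2.stepAux.eq_1, -TM2.stepAux.eq_3]

/-- The hypotheses let the matrix entries drive the loop: the other two stacks are empty by the time
these run out. -/
theorem clear_run (hr : r'.length ≤ e'.length) (hc : c'.length ≤ e'.length) :
    ReachesIn (TM2.step (program H)) (e'.length + 1)
      ⟨some .clear, ⟨re, ch, ca, fa, fi, none, ρ, β, γ⟩, store i o r r' c c' e e'⟩
      ⟨none, .start, store i ((!fa) :: o) r [] c [] e []⟩ := by
  induction e' generalizing r' c' ρ β γ with
  | nil =>
    obtain rfl : r' = [] := by simpa using hr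
    obtain rfl : c' = [] := by simpa using hc
    exact .single (by simp [program, -TM2.stepAux.eq_1, -TM2.stepAux.eq_3])
  | cons b e' ih =>
    refine .head ?_ (ih r'.tail c'.tail r'.head? c'.head? (some b) ?_ ?_)
    · simp [program, -TM2.stepAux.eq_1, -TM2.stepAux.eq_3]
    · simp only [List.length_cons, List.length_tail] at hr ⊢
      omega
    · simp only [List.length_cons, List.length_tail] at hc ⊢
      omega

theorem step_scanRow_false (L m A B) :
    TM2.step (program H) ⟨some .scanRow, ⟨re, ch, ca, fa, fi, none, some (L, m, A), β, γ⟩,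
      store i o r r' (B :: c) c' (false :: e) e'⟩ =
    some ⟨some .scanRow, ⟨re, ch, ca, fa, fi, none, some (L, m, A), some B, none⟩,
      store i o r r' c (B :: c') e (false :: e')⟩ := by
  simp [program, -TM2.stepAux.eq_1, -TM2.stepAux.eq_3]
  simp [scanStep]

open Classical in
theorem step_scanRow_true (L m A B) :
    TM2.step (program H) ⟨some .scanRow, ⟨re, ch, ca, fa, fi, none, some (L, m, A), β, γ⟩,
      store i o r r' (B :: c) c' (true :: e) e'⟩ =
    some ⟨some .scanRow, ⟨re, ch || !decide (reviseRow H A B = A ∧ reviseCol H A B = B),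
        ca, fa, fi, none, some (L, m, reviseRow H A B), some (reviseCol H A B), none⟩,
      store i o r r' c (reviseCol H A B :: c') e (true :: e')⟩ := by
  simp [program, -TM2.stepAux.eq_1, -TM2.stepAux.eq_3]
  simp [scanStep]

theorem step_scanRow_nil (x) :
    TM2.step (program H) ⟨some .scanRow, ⟨re, ch, ca, fa, fi, none, some x, β, γ⟩,
      store i o r r' [] c' e e'⟩ =
    some ⟨some .rewindCols, ⟨re, ch, ca, fa, fi, none, none, none, γ⟩,
      store i o r (x :: r') [] c' e e'⟩ := by
  simp [program, -TM2.stepAux.eq_1, -TM2.stepAux.eq_3]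

theorem scanRow_run {n : ℕ} (bits : Fin n → Bool) (L m A) (B : Fin n → Finset (W × W)) :
    ∃ A' B' ch', Revises H (fun _ : Fin 1 => bits) (fun _ => A) B ch (fun _ => A') B' ch' ∧
    ∃ γ', ReachesIn (TM2.step (program H)) (n + 1)
      ⟨some .scanRow, ⟨re, ch, ca, fa, fi, none, some (L, m, A), β, γ⟩,
        store i o r r' (List.ofFn B) c' (List.ofFn bits ++ e) e'⟩
      ⟨some .rewindCols, ⟨re, ch', ca, fa, fi, none, none, none, γ'⟩,
        store i o r ((L, m, A') :: r') [] ((List.ofFn B').reverse ++ c') e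
          ((List.ofFn bits).reverse ++ e')⟩ := by
  induction n generalizing A ch c' e' β γ with
  | zero =>
    exact ⟨A, B, ch, .refl H _ _ _ _ fun _ => finZeroElim, γ, .single (step_scanRow_nil ..)⟩
  | succ n ih =>
    obtain ⟨A₁, B₀, ch₁, h₁, hstep⟩ : ∃ A₁ B₀ ch₁,
        Revises H (fun _ _ : Fin 1 => bits 0) (fun _ => A) (fun _ => B 0) ch (fun _ => A₁)
          (fun _ => B₀) ch₁ ∧
        TM2.step (program H) ⟨some .scanRow, ⟨re, ch, ca, fa, fi, none, some (L, m, A), β, γ⟩,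
          store i o r r' (List.ofFn B) c' (List.ofFn bits ++ e) e'⟩ =
        some ⟨some .scanRow, ⟨re, ch₁, ca, fa, fi, none, some (L, m, A₁), some B₀, none⟩,
          store i o r r' (List.ofFn fun j => B j.succ) (B₀ :: c')
            (List.ofFn (fun j => bits j.succ) ++ e) (bits 0 :: e')⟩ := by
      simp only [List.ofFn_succ, List.cons_append]
      cases bits 0 with
      | false => exact ⟨A, B 0, ch, .refl H _ _ _ _ fun _ _ => rfl, step_scanRow_false ..⟩
      | true => exact ⟨_, _, _, revises_cell H A (B 0) ch, step_scanRow_true ..⟩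
    obtain ⟨A₂, B', ch₂, h₂, γ', hrun⟩ := ih (B₀ :: c') (bits 0 :: e') ch₁ (some B₀) none
      (fun j => bits j.succ) A₁ (fun j => B j.succ)
    have h := h₁.cons_col h₂
    rw [show (Fin.cons (bits 0) fun j => bits j.succ : Fin (n + 1) → Bool) = bits from
      Fin.cons_self_tail bits, show (Fin.cons (B 0) fun j => B j.succ) = B from
      Fin.cons_self_tail B] at h
    refine ⟨A₂, Fin.cons B₀ B', ch₂, h, γ', ?_⟩
    simpa [List.ofFn_succ] using ReachesIn.head hstep hrun

theorem step_nextRow_cons (x) :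
    TM2.step (program H) ⟨some .nextRow, ⟨re, ch, ca, fa, fi, none, ρ, β, γ⟩,
      store i o (x :: r) r' c c' e e'⟩ =
    some ⟨some .scanRow, ⟨re, ch, ca, fa, fi, none, some x, β, γ⟩,
      store i o r r' c c' e e'⟩ := by
  simp [program, -TM2.stepAux.eq_1, -TM2.stepAux.eq_3]

/-- The entries of a matrix, row by row. -/
def flatCells {m n : ℕ} (adj : Fin m → Fin n → Bool) : List Bool :=
  (List.ofFn fun i => List.ofFn (adj i)).flatten

theorem length_flatCells {m n : ℕ} (adj : Fin m → Fin n → Bool) :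
    (flatCells adj).length = m * n := by
  simp [flatCells, List.length_flatten, List.map_ofFn, Function.comp_def]

theorem nextRow_run {m n : ℕ} (adj : Fin m → Fin n → Bool) (L : Fin m → Finset W)
    (mk : Fin m → Bool) (A : Fin m → Finset (W × W)) (B : Fin n → Finset (W × W)) :
    ∃ A' B' ch', Revises H adj A B ch A' B' ch' ∧
    ∃ γ', ReachesIn (TM2.step (program H)) (m * (2 * n + 3) + 1)
      ⟨some .nextRow, ⟨re, ch, ca, fa, fi, none, ρ, none, γ⟩,
        store i o (List.ofFn fun i => (L i, mk i, A i)) r' (List.ofFn B) [] (flatCells adj) e'⟩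
      ⟨some .flipCols, ⟨re, ch', ca, fa, fi, none, none, none, γ'⟩,
        store i o [] ((List.ofFn fun i => (L i, mk i, A' i)).reverse ++ r') (List.ofFn B') [] []
          ((flatCells adj).reverse ++ e')⟩ := by
  induction m generalizing r' e' ch B ρ γ with
  | zero =>
    refine ⟨A, B, ch, .refl H _ _ _ _ finZeroElim, γ, ?_⟩
    refine (ReachesIn.single ?_).mono (Nat.le_add_left 1 _)
    simp [flatCells, program, -TM2.stepAux.eq_1, -TM2.stepAux.eq_3]
  | succ m ih =>
    obtain ⟨A₀, B₁, ch₁, h₁, γ₁, hrun₁⟩ := scanRow_run (H := H) i o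
      (List.ofFn fun i => (L i.succ, mk i.succ, A i.succ)) r' []
      (flatCells fun i => adj i.succ) e' re ch ca fa fi none γ (adj 0) (L 0) (mk 0) (A 0) B
    obtain ⟨A', B', ch', h₂, γ', hrun₂⟩ := ih ((L 0, mk 0, A₀) :: r')
      ((List.ofFn (adj 0)).reverse ++ e') ch₁ none γ₁ (fun i => adj i.succ)
      (fun i => L i.succ) (fun i => mk i.succ) (fun i => A i.succ) B₁
    have h := h₁.cons_row h₂
    rw [show (Fin.cons (adj 0) fun i => adj i.succ : Fin (m + 1) → Fin n → Bool) = adj from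
      Fin.cons_self_tail adj, show (Fin.cons (A 0) fun i => A i.succ) = A from
      Fin.cons_self_tail A] at h
    refine ⟨Fin.cons A₀ A', B', ch', h, γ', ?_⟩
    -- Scanning a row reverses the columns, so they are turned back before the next row.
    have hback := rewindCols_run (H := H) i o (List.ofFn fun i => (L i.succ, mk i.succ, A i.succ))
      ((L 0, mk 0, A₀) :: r') [] ((List.ofFn B₁).reverse) (flatCells fun i => adj i.succ)
      ((List.ofFn (adj 0)).reverse ++ e') re ch₁ ca fa fi none none γ₁
    simp only [List.append_nil, List.reverse_reverse, List.length_reverse, List.length_ofFn]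
      at hrun₁ hback
    have hrun := (ReachesIn.head (step_nextRow_cons (H := H) (ρ := ρ) ..) hrun₁).trans hback
    have hrun := hrun.trans hrun₂
    have hrun := hrun.mono (t := (m + 1) * (2 * n + 3) + 1) (by ring_nf; omega)
    simpa [List.ofFn_succ, flatCells] using hrun

-- The stacks have the last vertex on top, hence the induction splits off `Fin.last`.
open Classical in
theorem merge_run {n : ℕ} (L : Fin n → Finset W) (mk : Fin n → Bool)
    (A B : Fin n → Finset (W × W)) :
    ∃ ch', (ch' = true ↔ ch = true ∨ A ≠ B) ∧
    ReachesIn (TM2.step (program H)) (n + 1)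
      ⟨some .merge, ⟨false, ch, ca, fa, fi, none, ρ, β, γ⟩,
        store i o r (List.ofFn fun i => (L i, mk i, A i)).reverse c (List.ofFn B).reverse e e'⟩
      ⟨some .nextRow, ⟨false, ch', ca, fa, false, none, none, none, γ⟩,
        store i o ((List.ofFn fun i => (L i, mk i, A i ∩ B i)) ++ r) []
          ((List.ofFn fun i => A i ∩ B i) ++ c) [] e e'⟩ := by
  induction n generalizing r c ch ρ β with
  | zero =>
    refine ⟨ch, by simp [Subsingleton.elim A B], .single ?_⟩
    simp [program, -TM2.stepAux.eq_1, -TM2.stepAux.eq_3]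
  | succ n ih =>
    obtain ⟨ch', h, hrun⟩ := ih
      ((L (Fin.last n), mk (Fin.last n), A (Fin.last n) ∩ B (Fin.last n)) :: r)
      (A (Fin.last n) ∩ B (Fin.last n) :: c)
      (ch || !decide (A (Fin.last n) = B (Fin.last n)))
      (some (L (Fin.last n), mk (Fin.last n), A (Fin.last n) ∩ B (Fin.last n)))
      (some (A (Fin.last n) ∩ B (Fin.last n)))
      (fun i => L i.castSucc) (fun i => mk i.castSucc) (fun i => A i.castSucc)
      (fun i => B i.castSucc)
    refine ⟨ch', ?_, ?_⟩
    · rw [h]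
      simp only [ne_eq, funext_iff, Fin.forall_fin_succ' (n := n), Bool.or_eq_true,
        Bool.not_eq_true', decide_eq_false_iff_not]
      tauto
    · simp only [List.ofFn_succ' (n := n), List.concat_eq_append, List.reverse_append,
        List.append_assoc, List.reverse_singleton, List.singleton_append]
      refine .head ?_ hrun
      simp [program, -TM2.stepAux.eq_1, -TM2.stepAux.eq_3]
      simp [mergeStep]

-- Rows are met from last to first, so `carry` holds the mark of the row with the next higher index,
-- and the mark moves from `k` to `k - 1`. For `k = n` no row is marked and the mark enters through
-- `carry`; for `k = 0` it leaves through `carry`, which means that every vertex has been tested.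
open Classical in
theorem merge_restart_run {n : ℕ} (L : Fin n → Finset W) (k : ℕ)
    (A B : Fin n → Finset (W × W)) :
    ∃ fa', (fa' = true ↔ fa = true ∨ ∃ i : Fin n, i.val = k ∧ A i = ∅) ∧
    ReachesIn (TM2.step (program H)) (n + 1)
      ⟨some .merge, ⟨true, ch, decide (n = k), fa, fi, none, ρ, β, γ⟩,
        store i o r (List.ofFn fun i => (L i, decide (i.val = k), A i)).reverse c
          (List.ofFn B).reverse e e'⟩
      ⟨some .nextRow, ⟨false, ch, decide (0 = k), fa', decide (0 = k) || fa', none, none, none, γ⟩,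
        store i o
          ((List.ofFn fun i => (L i, decide (i.val + 1 = k),
            initialPairs (decide (i.val + 1 = k)) (L i))) ++ r) []
          ((List.ofFn fun i => initialPairs (decide (i.val + 1 = k)) (L i)) ++ c) [] e e'⟩ := by
  induction n generalizing r c fa ρ β with
  | zero =>
    refine ⟨fa, by simp, .single ?_⟩
    simp [program, -TM2.stepAux.eq_1, -TM2.stepAux.eq_3]
  | succ n ih =>
    obtain ⟨fa', h, hrun⟩ := ih
      ((L (Fin.last n), decide (n + 1 = k),
        initialPairs (decide (n + 1 = k)) (L (Fin.last n))) :: r)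
      (initialPairs (decide (n + 1 = k)) (L (Fin.last n)) :: c)
      (fa || (decide (n = k) && decide (A (Fin.last n) = ∅)))
      (some (L (Fin.last n), decide (n + 1 = k),
        initialPairs (decide (n + 1 = k)) (L (Fin.last n))))
      (some (initialPairs (decide (n + 1 = k)) (L (Fin.last n))))
      (fun i => L i.castSucc) (fun i => A i.castSucc) (fun i => B i.castSucc)
    refine ⟨fa', ?_, ?_⟩
    · rw [h]
      simp only [Fin.exists_fin_succ' (n := n), Bool.or_eq_true, Bool.and_eq_true,
        decide_eq_true_eq, Fin.val_last, Fin.val_castSucc]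
      exact or_assoc.trans (or_congr_right or_comm)
    · simp only [List.ofFn_succ' (n := n), List.concat_eq_append, List.reverse_append,
        List.append_assoc, List.reverse_singleton, List.singleton_append]
      refine .head ?_ hrun
      simp [program, -TM2.stepAux.eq_1, -TM2.stepAux.eq_3]
      simp [mergeStep]

/-- The word that is read: the rows of the matrix, each preceded by the list of its vertex. -/
def word {m n : ℕ} (adj : Fin m → Fin n → Bool) (L : Fin m → Finset W) : List (Finset W ⊕ Bool) :=
  (List.ofFn fun i => Sum.inl (L i) :: List.ofFn fun j => Sum.inr (adj i j)).flatten

theorem parse_bits_run (bs : List Bool) (x : Option (Finset W ⊕ Bool)) :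
    ∃ x', ReachesIn (TM2.step (program H)) bs.length
      ⟨some .parse, ⟨re, ch, ca, fa, fi, x, ρ, β, γ⟩,
        store (bs.map Sum.inr ++ i) o r r' c c' e e'⟩
      ⟨some .parse, ⟨re, ch, ca, fa, fi, x', ρ, β, γ⟩,
        store i o r r' c c' e (bs.reverse ++ e')⟩ := by
  induction bs generalizing e' x with
  | nil => exact ⟨x, .refl _⟩
  | cons b bs ih =>
    obtain ⟨x', hrun⟩ := ih (b :: e') (some (.inr b))
    refine ⟨x', ?_⟩
    rw [List.reverse_cons, List.append_assoc]
    refine .head ?_ hrun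
    simp [program, -TM2.stepAux.eq_1, -TM2.stepAux.eq_3]

theorem parse_run {m n : ℕ} (adj : Fin m → Fin n → Bool) (L : Fin m → Finset W)
    (x : Option (Finset W ⊕ Bool)) :
    ReachesIn (TM2.step (program H)) (m * (n + 1) + 1)
      ⟨some .parse, ⟨re, ch, ca, fa, fi, x, ρ, β, γ⟩,
        store (word adj L) o r r' c c' e e'⟩
      ⟨some .unreadCells, ⟨re, ch, ca, fa, fi, none, ρ, β, γ⟩,
        store [] o r ((List.ofFn fun i => (L i, false, ∅)).reverse ++ r') c
          ((List.ofFn fun _ : Fin m => ∅).reverse ++ c') e ((flatCells adj).reverse ++ e')⟩ := by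
  induction m generalizing r' c' e' x with
  | zero =>
    refine (ReachesIn.single ?_).mono (Nat.le_add_left 1 _)
    simp [word, flatCells, program, -TM2.stepAux.eq_1, -TM2.stepAux.eq_3]
  | succ m ih =>
    obtain ⟨x', hrun⟩ := parse_bits_run (H := H) (word (fun i => adj i.succ) fun i => L i.succ) o r
      ((L 0, false, ∅) :: r') c (∅ :: c') e e' re ch ca fa fi ρ β γ (List.ofFn (adj 0))
      (some (.inl (L 0)))
    have hrun := hrun.trans (ih ((L 0, false, ∅) :: r') (∅ :: c')
      ((List.ofFn (adj 0)).reverse ++ e') (fun i => adj i.succ) (fun i => L i.succ) x')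
    have hstep : TM2.step (program H) ⟨some .parse, ⟨re, ch, ca, fa, fi, x, ρ, β, γ⟩,
        store (word adj L) o r r' c c' e e'⟩ =
      some ⟨some .parse, ⟨re, ch, ca, fa, fi, some (.inl (L 0)), ρ, β, γ⟩,
        store ((List.ofFn (adj 0)).map Sum.inr ++ word (fun i => adj i.succ) fun i => L i.succ) o r
          ((L 0, false, ∅) :: r') c (∅ :: c') e e'⟩ := by
      simp [word, List.map_ofFn, Function.comp_def, program,
        -TM2.stepAux.eq_1, -TM2.stepAux.eq_3]
    have hrun := (ReachesIn.head hstep hrun).mono (t := (m + 1) * (n + 1) + 1)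
      (by rw [List.length_ofFn]; ring_nf; omega)
    simpa [List.ofFn_succ, flatCells] using hrun

end loops

/-! ### Rounds of the machine. -/

-- If the two copies differ somewhere, intersecting them deletes a pair from at least one copy,
-- which pays for the flag.
open Classical in
theorem sum_card_inter_add_le {n : ℕ} (A B : Fin n → Finset (W × W)) (ch : Bool)
    (h : ch = true → A ≠ B) :
    ∑ i, (A i ∩ B i).card + ∑ i, (A i ∩ B i).card + ch.toNat ≤
      ∑ i, (A i).card + ∑ i, (B i).card := by
  have hA : ∀ i, (A i ∩ B i).card ≤ (A i).card := fun i =>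
    Finset.card_le_card Finset.inter_subset_left
  have hB : ∀ i, (A i ∩ B i).card ≤ (B i).card := fun i =>
    Finset.card_le_card Finset.inter_subset_right
  have hA' := Finset.sum_le_sum fun i (_ : i ∈ Finset.univ) => hA i
  have hB' := Finset.sum_le_sum fun i (_ : i ∈ Finset.univ) => hB i
  cases ch with
  | false => simpa using Nat.add_le_add hA' hB'
  | true =>
    obtain ⟨i, hi⟩ := Function.ne_iff.1 (h rfl)
    rw [← Finset.sum_add_distrib, ← Finset.sum_add_distrib]
    refine Finset.sum_lt_sum (fun i _ => Nat.add_le_add (hA i) (hB i)) ⟨i, Finset.mem_univ i, ?_⟩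
    by_contra hlt
    have hA := hA i
    have hB := hB i
    exact hi ((Finset.eq_of_subset_of_card_le Finset.inter_subset_left (by omega)).symm.trans
      (Finset.eq_of_subset_of_card_le Finset.inter_subset_right (by omega)))

section run

variable [Fintype W] (H : Digraph W) {n : ℕ} (adj : Fin n → Fin n → Bool) (L : Fin n → Finset W)

/-- The configuration before a round: the vertex `k` is marked. -/
def roundCfg (k : ℕ) (ch : Bool) (A B : Fin n → Finset (W × W)) (γ : Option Bool) :
    TM2.Cfg (Alphabet W) Label (State W) :=
  ⟨some .unreadCells, ⟨false, ch, decide (n = k), false, false, none, none, none, γ⟩,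
    store [] [] [] (List.ofFn fun i => (L i, decide (i.val = k), A i)).reverse []
      (List.ofFn B).reverse [] (flatCells adj).reverse⟩

/-- The final configuration. -/
def answerCfg (ans : Bool) : TM2.Cfg (Alphabet W) Label (State W) :=
  ⟨none, .start, store [] [ans] [] [] [] [] [] []⟩

/-- A bound for the number of steps of a round. -/
def roundTime (n : ℕ) : ℕ := 4 * (n * n) + 5 * n + 5

theorem revise_run (mk : Fin n → Bool) (ca fa fi ch : Bool) (A B : Fin n → Finset (W × W))
    (γ : Option Bool) :
    ∃ A' B' ch', Revises H adj A B ch A' B' ch' ∧ ∃ γ',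
    ReachesIn (TM2.step (program H)) (n * (2 * n + 3) + 1 + (n + 1))
      ⟨some .nextRow, ⟨false, ch, ca, fa, fi, none, none, none, γ⟩,
        store [] [] (List.ofFn fun i => (L i, mk i, A i)) [] (List.ofFn B) []
          (flatCells adj) []⟩
      ⟨some (if fi then .clear else .unreadCells), ⟨false, ch', ca, fa, fi, none, none, none, γ'⟩,
        store [] [] [] (List.ofFn fun i => (L i, mk i, A' i)).reverse []
          (List.ofFn B').reverse [] (flatCells adj).reverse⟩ := by
  obtain ⟨A', B', ch', h, γ', hrun⟩ := nextRow_run (H := H) [] [] [] [] false ch ca fa fi none γ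
    adj L mk A B
  refine ⟨A', B', ch', h, γ', ?_⟩
  have := flipCols_run (H := H) [] [] [] (List.ofFn fun i => (L i, mk i, A' i)).reverse
    (List.ofFn B') [] [] (flatCells adj).reverse false ch' ca fa fi none none γ'
  simp only [List.append_nil, List.length_ofFn] at this hrun
  exact hrun.trans this

open Classical in
theorem round_run (k : ℕ) (A B : Fin n → Finset (W × W)) (γ : Option Bool) :
    ∃ ch₁ A' B' ch', (ch₁ = true ↔ A ≠ B) ∧
    Revises H adj (fun i => A i ∩ B i) (fun i => A i ∩ B i) ch₁ A' B' ch' ∧ ∃ γ',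
    ReachesIn (TM2.step (program H)) (roundTime n) (roundCfg adj L k true A B γ)
      (roundCfg adj L k ch' A' B' γ') := by
  have h₁ := unreadCells_run (H := H) [] [] []
    (List.ofFn fun i => (L i, decide (i.val = k), A i)).reverse [] (List.ofFn B).reverse [] (flatCells adj).reverse false true (decide (n = k)) false false none
    none γ
  obtain ⟨ch₁, hch₁, h₂⟩ := merge_run (H := H) [] [] [] [] (flatCells adj) [] false (decide (n = k))
    false false none none none L (fun i => decide (i.val = k)) A B
  obtain ⟨A', B', ch', h, γ', h₃⟩ := revise_run H adj L (fun i => decide (i.val = k))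
    (decide (n = k)) false false ch₁
    (fun i => A i ∩ B i) (fun i => A i ∩ B i) none
  refine ⟨ch₁, A', B', ch', by simpa using hch₁, h, γ', ?_⟩
  simp only [List.append_nil, List.length_reverse, length_flatCells, List.reverse_reverse] at h₁ h₂
  exact ((h₁.trans h₂).trans h₃).mono (by rw [roundTime]; ring_nf; omega)

theorem restart_run (k : ℕ) (A B : Fin n → Finset (W × W)) (γ : Option Bool) :
    ∃ fa, (fa = true ↔ ∃ i : Fin n, i.val = k ∧ A i = ∅) ∧
    ((k = 0 ∨ fa = true) →
      ReachesIn (TM2.step (program H)) (roundTime n) (roundCfg adj L k false A B γ)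
        (answerCfg !fa)) ∧
    ∀ k', k = k' + 1 → k ≤ n → fa = false → ∃ A' B' ch',
      Revises H adj (fun i => initialPairs (decide (i.val = k')) (L i))
        (fun i => initialPairs (decide (i.val = k')) (L i)) true A' B' ch' ∧ ∃ γ',
      ReachesIn (TM2.step (program H)) (roundTime n) (roundCfg adj L k false A B γ)
        (roundCfg adj L k' ch' A' B' γ') := by
  have h₁ := unreadCells_run (H := H) [] [] []
    (List.ofFn fun i => (L i, decide (i.val = k), A i)).reverse [] (List.ofFn B).reverse [] (flatCells adj).reverse false false (decide (n = k)) false false none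
    none γ
  obtain ⟨fa, hfa, h₂⟩ := merge_restart_run (H := H) [] [] [] [] (flatCells adj) [] true
    false false none none none L k A B
  simp only [List.append_nil, List.length_reverse, length_flatCells, List.reverse_reverse,
    Bool.not_false] at h₁ h₂
  refine ⟨fa, hfa.trans (by simp only [Bool.false_eq_true, false_or]), fun hfin => ?_, ?_⟩
  -- Even with the answer known, one more pass over the matrix takes place before the stacks are
  -- cleared; what it does to the sets is irrelevant.
  · obtain ⟨A', B', ch', -, γ', h₃⟩ := revise_run H adj L (fun i => decide (i.val + 1 = k))
      (decide (0 = k)) fa true true (fun i => initialPairs (decide (i.val + 1 = k)) (L i))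
      (fun i => initialPairs (decide (i.val + 1 = k)) (L i)) none
    have hfin : (decide (0 = k) || fa) = true := by
      rcases hfin with rfl | rfl <;> simp
    have h₄ := clear_run (H := H) [] [] []
      (List.ofFn fun i => (L i, decide (i.val + 1 = k), A' i)).reverse [] (List.ofFn B').reverse []
      (flatCells adj).reverse false ch' (decide (0 = k)) fa true none none γ'
      (by simpa [length_flatCells] using Nat.le_mul_self n)
      (by simpa [length_flatCells] using Nat.le_mul_self n)
    rw [hfin] at h₂
    rw [if_pos rfl] at h₃
    rw [List.length_reverse, length_flatCells] at h₄
    have hrun := ((h₁.trans h₂).trans h₃).trans h₄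
    exact hrun.mono (by rw [roundTime]; ring_nf; omega)
  · rintro k' rfl hk rfl
    obtain ⟨A', B', ch', h, γ', h₃⟩ := revise_run H adj L (fun i => decide (i.val = k'))
      (decide (n = k')) false false true
      (fun i => initialPairs (decide (i.val = k')) (L i))
      (fun i => initialPairs (decide (i.val = k')) (L i)) none
    refine ⟨A', B', ch', h, γ', ?_⟩
    have hk' : n ≠ k' := by omega
    have hfin : (decide (0 = k' + 1) || false) = false := by simp
    -- Both sides are false, as `k' < n`; the right one is the form demanded by `roundCfg`.
    have hcarry : decide (0 = k' + 1) = decide (n = k') := by simp [hk']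
    rw [hfin, hcarry] at h₂
    simp only [Nat.add_right_cancel_iff] at h₂
    have hrun := (h₁.trans h₂).trans h₃
    exact hrun.mono (by rw [roundTime]; ring_nf; omega)

end run

/-! ### Correctness and number of rounds. -/

/-- What holds before each round. -/
structure RoundInvariant (H : Digraph W) (I : ListColoringInput W) (k : ℕ) (ch : Bool)
    (A B : Fin I.n → Finset (W × W)) : Prop where
  le : k ≤ I.n
  lists : ∀ i, ∀ p ∈ A i, p.2 ∈ I.lists i
  diag : ∀ i : Fin I.n, i.val = k → ∀ p ∈ A i, p.1 = p.2
  sound : ∀ f, I.graph.IsHom H f → (∀ v, f v ∈ I.lists v) → ∀ r : Fin I.n, r.val = k →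
    ∀ i, (f r, f i) ∈ A i ∧ (f r, f i) ∈ B i
  done : ∀ r : Fin I.n, k < r.val → I.ConsistentAt H r
  stable : ch = false → k < I.n → A = B ∧ ∀ i j, I.graph.Adj i j → Supports H (A i) (A j)

variable {H : Digraph W} {I : ListColoringInput W} {k : ℕ} {ch : Bool}
  {A B : Fin I.n → Finset (W × W)}

/-- Any surviving pair at `r` is diagonal, say `(a, a)`. The slices of all sets at first coordinate
`a` form the family, since supports preserve that coordinate. Slices may be empty at vertices not
connected to `r`. -/
theorem RoundInvariant.consistentAt (h : RoundInvariant H I k false A B) (r : Fin I.n)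
    (hr : r.val = k) (hA : A r ≠ ∅) : I.ConsistentAt H r := by
  obtain ⟨⟨a, x⟩, hx⟩ := Finset.nonempty_iff_ne_empty.2 hA
  obtain rfl : a = x := h.diag r hr _ hx
  have hs := (h.stable rfl (hr ▸ r.2)).2
  refine ⟨a, fun v => {x | (a, x) ∈ A v}, ?_, fun v x hx => h.lists v _ hx,
    fun u v huv x hx => (hs u v huv).1 a x hx, fun u v huv y hy => (hs u v huv).2 a y hy⟩
  ext x
  exact ⟨fun hx => (h.diag r hr _ hx).symm, by rintro rfl; exact hx⟩

open Classical in
theorem RoundInvariant.round {ch₁ ch' : Bool} {A' B' : Fin I.n → Finset (W × W)}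
    (h : RoundInvariant H I k true A B)
    (hr : Revises H (fun i j => decide (I.graph.Adj i j)) (fun i => A i ∩ B i) (fun i => A i ∩ B i)
      ch₁ A' B' ch') : RoundInvariant H I k ch' A' B' where
  le := h.le
  lists i p hp := h.lists i p (Finset.mem_of_mem_inter_left (hr.subset_row i hp))
  diag i hi p hp := h.diag i hi p (Finset.mem_of_mem_inter_left (hr.subset_row i hp))
  sound f hf hL r hrk i := by
    have h := fun i => Finset.mem_inter.2 (h.sound f hf hL r hrk i)
    have := hr.sound (f r) f f h h fun i j hij => hf i j (of_decide_eq_true hij)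
    exact ⟨this.1 i, this.2 i⟩
  done := h.done
  stable hc _ := by
    obtain ⟨-, rfl, rfl, hs⟩ := hr.stable hc
    exact ⟨rfl, fun i j hij => hs i j (decide_eq_true hij)⟩

open Classical in
theorem RoundInvariant.restart [Fintype W] {ch' : Bool} {A' B' : Fin I.n → Finset (W × W)}
    (h : RoundInvariant H I (k + 1) false A B) (hA : ¬∃ i : Fin I.n, i.val = k + 1 ∧ A i = ∅)
    (hr : Revises H (fun i j => decide (I.graph.Adj i j))
      (fun i => initialPairs (decide (i.val = k)) (I.lists i))
      (fun i => initialPairs (decide (i.val = k)) (I.lists i)) true A' B' ch') :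
    RoundInvariant H I k ch' A' B' where
  le := (Nat.le_succ k).trans h.le
  lists i p hp := (Finset.mem_filter.1 (hr.subset_row i hp)).2.1
  diag i hi p hp := (Finset.mem_filter.1 (hr.subset_row i hp)).2.2 (decide_eq_true hi)
  sound f hf hL r hrk i := by
    have h : ∀ i, (f r, f i) ∈ initialPairs (decide (i.val = k)) (I.lists i) := by
      intro i
      refine Finset.mem_filter.2 ⟨Finset.mem_univ _, hL i, fun hi => congrArg f (Fin.ext ?_)⟩
      rw [hrk, of_decide_eq_true hi]
    have := hr.sound (f r) f f h h fun i j hij => hf i j (of_decide_eq_true hij)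
    exact ⟨this.1 i, this.2 i⟩
  done r hrk := by
    rcases (Nat.succ_le_of_lt hrk).eq_or_lt with h' | h'
    · exact h.consistentAt r h'.symm fun h0 => hA ⟨r, h'.symm, h0⟩
    · exact h.done r h'
  stable hc _ := by
    -- A restart begins with the flag up and a pass never lowers it, so `ch' = false` is impossible.
    have := (hr.stable hc).1
    contradiction

theorem sum_card_le [Fintype W] {n : ℕ} (A : Fin n → Finset (W × W)) :
    ∑ i, (A i).card ≤ n * Fintype.card (W × W) := by
  simpa using Finset.sum_le_card_nsmul Finset.univ _ _ fun i _ => Finset.card_le_univ (A i)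

-- The potential bounded by `N` falls in each round that does not give the answer. In an
-- intersecting round the flag that was up is used up, and new changes are paid for by deleted
-- pairs. At a restart `k` drops by one.
open Classical in
theorem rounds_run [Fintype W] (hI : I.graph.maxInDeg ≤ 1 ∨ I.graph.maxOutDeg ≤ 1) (N : ℕ)
    (h : RoundInvariant H I k ch A B) (γ : Option Bool)
    (hN : k * (2 * (I.n * Fintype.card (W × W)) + 2) + (∑ i, (A i).card + ∑ i, (B i).card) +
      ch.toNat ≤ N) :
    ReachesIn (TM2.step (program H)) ((N + 1) * roundTime I.n)
      (roundCfg (fun i j => decide (I.graph.Adj i j)) I.lists k ch A B γ)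
      (answerCfg (decide (I.HasListColoring H))) := by
  induction N using Nat.strong_induction_on generalizing k ch A B γ with
  | _ N ih =>
  have step : ∀ {k' ch' A' B' γ'}, RoundInvariant H I k' ch' A' B' →
      k' * (2 * (I.n * Fintype.card (W × W)) + 2) + (∑ i, (A' i).card + ∑ i, (B' i).card) +
        ch'.toNat < N →
      ReachesIn (TM2.step (program H)) (roundTime I.n)
        (roundCfg (fun i j => decide (I.graph.Adj i j)) I.lists k ch A B γ)
        (roundCfg (fun i j => decide (I.graph.Adj i j)) I.lists k' ch' A' B' γ') →
      ReachesIn (TM2.step (program H)) ((N + 1) * roundTime I.n)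
        (roundCfg (fun i j => decide (I.graph.Adj i j)) I.lists k ch A B γ)
        (answerCfg (decide (I.HasListColoring H))) := by
    intro k' ch' A' B' γ' h' hlt hrun
    obtain ⟨N, rfl⟩ := Nat.exists_eq_succ_of_ne_zero (Nat.ne_zero_of_lt hlt)
    exact (hrun.trans (ih N N.lt_succ_self h' γ' (Nat.le_of_lt_succ hlt))).mono
      (by rw [Nat.succ_eq_add_one]; ring_nf; omega)
  cases ch with
  | true =>
    obtain ⟨ch₁, A', B', ch', h₁, hr, γ', hrun⟩ := round_run H
      (fun i j => decide (I.graph.Adj i j)) I.lists k A B γ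
    refine step (h.round hr) ?_ hrun
    have := hr.card_le
    have := sum_card_inter_add_le A B ch₁ h₁.1
    simp only [Bool.toNat_true] at hN
    omega
  | false =>
    obtain ⟨fa, hfa, hfin, hnext⟩ := restart_run H
      (fun i j => decide (I.graph.Adj i j)) I.lists k A B γ
    by_cases hk : k = 0 ∨ fa = true
    · have hans : (!fa) = decide (I.HasListColoring H) := by
        cases fa with
        | true =>
          obtain ⟨i, hi, hA⟩ := hfa.1 rfl
          have : ¬I.HasListColoring H := by
            rintro ⟨f, hf, hL⟩
            have := (h.sound f hf hL i hi i).1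
            simp [hA] at this
          simp [this]
        | false =>
          have hA : ¬∃ i : Fin I.n, i.val = k ∧ A i = ∅ := fun h => by simpa using hfa.2 h
          obtain rfl : k = 0 := by simpa using hk
          have : I.HasListColoring H := by
            refine ListColoringInput.hasListColoring_of_consistentAt hI fun r => ?_
            rcases Nat.eq_zero_or_pos r.val with h0 | h0
            · exact h.consistentAt r h0 fun h1 => hA ⟨r, h0, h1⟩
            · exact h.done r h0
          simp [this]
      rw [← hans]
      exact (hfin hk).mono (Nat.le_mul_of_pos_left _ N.succ_pos)
    · push Not at hk
      obtain ⟨k', rfl⟩ := Nat.exists_eq_succ_of_ne_zero hk.1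
      have hfa' : fa = false := by simpa using hk.2
      obtain ⟨A', B', ch', hr, γ', hrun⟩ := hnext k' rfl h.le hfa'
      refine step (h.restart (fun h => hk.2 (hfa.2 h)) hr) ?_ hrun
      have h₁ := hr.card_le
      have h₂ := sum_card_le (fun i : Fin I.n => initialPairs (decide (i.val = k')) (I.lists i))
      rw [Bool.toNat_true] at h₁
      -- The released weight `2 * (n * |W × W|) + 2` covers two copies of full sets of pairs and the
      -- raised flag, with 1 to spare for the strict decrease.
      rw [Nat.succ_mul] at hN
      omega

/-- Rewrites the time in terms of the input length `n * (n + 1)`, which dominates `n`. -/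
theorem time_le (n c : ℕ) :
    n * (n + 1) + 1 + (n * (2 * (n * c) + 2) + 1) * roundTime n ≤
      n * (n + 1) + 1 +
        (n * (n + 1) * (2 * (n * (n + 1) * c) + 2) + 1) * (9 * (n * (n + 1)) + 5) := by
  have h : n ≤ n * (n + 1) := Nat.le_mul_of_pos_right n n.succ_pos
  have h' : roundTime n ≤ 9 * (n * (n + 1)) + 5 := by
    rw [roundTime]
    nlinarith
  gcongr

/-! ### Assembly of the polynomial-time machine. -/

/-- The machine that solves the list colouring problem. -/
noncomputable def machine {W : Type} [Fintype W] (H : Digraph W) : FinTM2 where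
  K := Stack
  k₀ := .input
  k₁ := .output
  Γ := Alphabet W
  Λ := Label
  main := .parse
  σ := State W
  initialState := .start
  Γk₀Fin := inferInstanceAs (Fintype (Finset W ⊕ Bool))
  m := program H

theorem initList_machine {W : Type} [Fintype W] (H : Digraph W) (w : List (Finset W ⊕ Bool)) :
    initList (machine H) w = (⟨some .parse, .start, store w [] [] [] [] [] [] []⟩ :
      TM2.Cfg (Alphabet W) Label (State W)) := by
  refine congrArg (TM2.Cfg.mk _ _) (funext fun k => ?_)
  cases k <;> rfl

theorem haltList_machine {W : Type} [Fintype W] (H : Digraph W) (ans : Bool) :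
    haltList (machine H) [ans] = (answerCfg ans : TM2.Cfg (Alphabet W) Label (State W)) := by
  refine congrArg (TM2.Cfg.mk _ _) (funext fun k => ?_)
  cases k <;> rfl

open Classical in
theorem machine_run {W : Type} [Fintype W] (H : Digraph W) (I : ListColoringInput W)
    (hI : I.graph.maxInDeg ≤ 1 ∨ I.graph.maxOutDeg ≤ 1) :
    ReachesIn (TM2.step (program H))
      (I.n * (I.n + 1) + 1 + (I.n * (2 * (I.n * Fintype.card (W × W)) + 2) + 1) * roundTime I.n)
      ⟨some .parse, .start, store I.encode [] [] [] [] [] [] []⟩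
      (answerCfg (decide (I.HasListColoring H))) := by
  have h₁ := parse_run (H := H) [] [] [] [] [] [] [] false false true false false none none none
    (fun i j => decide (I.graph.Adj i j)) I.lists none
  -- After parsing, no row is marked and `carry` is true, which is the situation `k = n` with empty
  -- sets. The first merge is a restart that marks the last vertex.
  have h₂ := rounds_run (H := H) (I := I) (k := I.n) (ch := false) (A := fun _ => ∅)
    (B := fun _ => ∅) hI _
    { le := le_rfl
      lists := by simp
      diag := by simp
      sound := fun f _ _ r hr => absurd hr r.2.ne
      done := fun r hr => absurd hr r.2.not_gt
      stable := fun _ h => absurd h (lt_irrefl _) } none le_rfl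
  refine (ReachesIn.trans (b := roundCfg (fun i j => decide (I.graph.Adj i j)) I.lists I.n false
    (fun _ => ∅) (fun _ => ∅) none) (s := I.n * (I.n + 1) + 1) ?_ h₂).mono (by simp)
  have hmk : ∀ i : Fin I.n, (i.val = I.n) = False := fun i => by simpa using i.2.ne
  have hcfg : roundCfg (fun i j => decide (I.graph.Adj i j)) I.lists I.n false (fun _ => ∅)
      (fun _ => ∅) none = ⟨some .unreadCells, .start, store [] [] []
        ((List.ofFn fun i => (I.lists i, false, ∅)).reverse ++ []) []
        ((List.ofFn fun _ : Fin I.n => ∅).reverse ++ []) []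
        ((flatCells fun i j => decide (I.graph.Adj i j)).reverse ++ [])⟩ := by
    simp [roundCfg, hmk, State.start]
  rw [hcfg]
  exact h₁

end ListColoringMachine

open ListColoringMachine in
theorem mainTheorem2 {W : Type} [Fintype W] (H : Digraph W) :
    PolyTimeSolvable
      (fun I : {I : ListColoringInput W //
          (I.graph.maxOutDeg ≤ 2 ∧ I.graph.maxInDeg ≤ 1) ∨
          (I.graph.maxOutDeg ≤ 1 ∧ I.graph.maxInDeg ≤ 2)} => I.1.encode)
      (fun I => I.1.HasListColoring H) := by
  classical
  refine ⟨{
    tm := machine H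
    inputAlphabet := Equiv.refl _
    outputAlphabet := Equiv.refl _
    time := .X + 1 + (.X * (2 * (.X * .C (Fintype.card (W × W))) + 2) + 1) * (9 * .X + 5)
    outputsFun := fun I => ?_ }⟩
  have hrun := (machine_run H I.1 (I.2.imp And.right And.left)).mono (time_le _ _)
  have hstart : initList (machine H) (List.map (Equiv.refl _).invFun I.1.encode) =
      (⟨some .parse, .start, store I.1.encode [] [] [] [] [] [] []⟩ :
        TM2.Cfg (Alphabet W) Label (State W)) := by
    rw [← initList_machine]
    exact congrArg _ (List.map_id _)
  have htime : ∀ n : ℕ, Polynomial.eval n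
      (.X + 1 + (.X * (2 * (.X * .C (Fintype.card (W × W))) + 2) + 1) * (9 * .X + 5)) =
      n + 1 + (n * (2 * (n * Fintype.card (W × W)) + 2) + 1) * (9 * n + 5) := by
    intro n
    simp
  rw [htime, I.1.length_encode]
  -- The goal is data containing the number of steps, while `ReachesIn` only asserts that such a
  -- number exists.
  refine Nonempty.some ?_
  obtain ⟨t, ht, hrun⟩ := hrun
  refine ⟨⟨⟨t, ?_⟩, ht⟩⟩
  exact (congrArg (fun c => (flip bind (TM2.step (program H)))^[t] (some c)) hstart).trans
    (hrun.trans (congrArg some (haltList_machine H _).symm))
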